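/- All graphs are finite and simple, and "contains" refers to (not necessarily induced) subgraphs. Let $H$ be a graph with at least two vertices. For a graph $G$, the $H$-chromatic number $\chi_H(G)$ is the minimum number of classes in a partition of $V(G)$ such that no class induces a subgraph of $G$ containing $H$. A graph $G$ is an $H$-forest if $G$ is (isomorphic to) a subgraph of a union of copies of $H$ such that any two distinct of the specified copies have at most one common vertex and every cycle in $G$ is contained in one of the specified copies. Let $F_1,\dots,F_m$ be finitely many graphs, none of which is an $H$-forest. Then for every $k\ge 1$ there is a graph $G$ that contains none of $F_1,\dots,F_m$ and satisfies $\chi_H(G)=k$. In particular, if $m\ge 3$ is less than the girth of $H$ (the girth being $\infty$ when $H$ has no cycle), then the cycle $C_m$ is not an $H$-forest, and hence there exist $C_m$-free graphs with arbitrarily large $H$-chromatic number. -/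

import Mathlib

namespace GeneralizedColoring

/-- `K` is a copy of `H` inside the graph `U`: a (not necessarily induced) subgraph of `U`
isomorphic to `H`. -/
def IsCopyOf {V X : Type*} (H : SimpleGraph V) {U : SimpleGraph X} (K : U.Subgraph) : Prop :=
  Nonempty (H ≃g K.coe)

/-- The (finite) graph `G` is an `H`-forest: up to isomorphism (the embedding `f`), `G` is a
subgraph of the union of a set `C` of copies of `H` (all inside some finite graph `U`) such that
any two distinct members of `C` have at most one common vertex and every cycle of `G` is contained
in some member of `C`. -/
def IsHForest {V W : Type*} (H : SimpleGraph V) (G : SimpleGraph W) : Prop :=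
  ∃ (N : ℕ) (U : SimpleGraph (Fin N)) (C : Set U.Subgraph) (f : SimpleGraph.Copy G U),
    (∀ K ∈ C, IsCopyOf H K) ∧
    (∀ K ∈ C, ∀ L ∈ C, K ≠ L → (K.verts ∩ L.verts).Subsingleton) ∧
    f.toSubgraph ≤ sSup C ∧
    ∀ (v : W) (p : G.Walk v v), p.IsCycle → ∃ K ∈ C, (p.map f.toHom).toSubgraph ≤ K

/-- The vertices of `G` can be partitioned into (at most) `k` classes, each inducing a subgraph of
`G` that does not contain `H` as a (not necessarily induced) subgraph. -/
def IsHColorable {V W : Type*} (H : SimpleGraph V) (G : SimpleGraph W) (k : ℕ) : Prop :=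
  ∃ c : W → Fin k, ∀ i : Fin k, H.Free (G.induce {v | c v = i})

/-- The `H`-chromatic number of `G`: the least `k` such that `G` is `H`-colorable with `k` classes
(and `⊤` if there is none). -/
noncomputable def hChromaticNumber {V W : Type*} (H : SimpleGraph V) (G : SimpleGraph W) : ℕ∞ :=
  ⨅ k ∈ {k : ℕ | IsHColorable H G k}, (k : ℕ∞)

end GeneralizedColoring

/-!
The graph `G` is obtained from a hypergraph whose hyperedges have `|V(H)|` points by placing a copy
of `H` on each hyperedge. If every coloring of the hypergraph with `k` colors has a monochromatic
hyperedge, then in every partition of `V(G)` into `k` classes some class contains `H`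
(`not_isHColorable_hyperedgeGraph`). If the hypergraph has no short cycles, then small subgraphs of
`G` are `H`-forests (`isHForest_of_isContained_hyperedgeGraph`), so `G` contains no `F_i`. A minimal
set of vertices inducing a subgraph that is not colorable with `k - 1` classes then has
`H`-chromatic number exactly `k` (`exists_hChromaticNumber_eq_succ`).

The absence of short cycles is expressed by counting (`LocallySparse`): with `q = |V(H)| - 1`, any
`t ≤ s` hyperedges cover more than `q * t` points. A path of length less than `s` with both ends on
one hyperedge stays in it (`LocallySparse.support_subset_of_isPath`), since the hyperedges along the
path would otherwise, together with that hyperedge, cover too few points. Removing an edge from a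
cycle of `G` leaves such a path, so each short cycle lies in one copy of `H`.

The hypergraph comes from the first moment method (`exists_locallySparse_not_colorable`). Take
`A * n` random tuples on `n` points. The expected number of sets of at most `s` tuples violating
sparsity is at most a constant `C` (`sum_card_denseSubfamilies_le`). The number of monochromatic
tuples of a fixed coloring is so rarely at most `2 * C` that, for `A` and `n` large, a union bound
over all `k ^ n` colorings is affordable (`sum_half_pow_card_le`). Deleting a tuple from each
violating set yields the hypergraph.

For the statement on cycles, the cycle of length `m` is an `H`-forest only if `H` has a cycle of
length `m` (`IsHForest.egirth_le`).
-/

namespace GeneralizedColoring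

/-! ### Locally sparse families of finite sets -/

/-- A family `E` of finite sets is locally sparse if any `t` of its members, `1 ≤ t ≤ s`, cover more
than `q * t` points. When every member has `q + 1` points this says that each subfamily of at most
`s` members is a hyperforest, i.e. that the hypergraph `E` has no Berge cycle of length at most `s`
(`s ≥ 2`); the counting form avoids any mention of hypergraph cycles. -/
def LocallySparse {ι Y : Type*} [DecidableEq Y] (q s : ℕ) (E : ι → Finset Y) : Prop :=
  ∀ T : Finset ι, T.Nonempty → T.card ≤ s → q * T.card < (T.biUnion E).card

namespace LocallySparse

variable {ι Y : Type*} [DecidableEq Y] {q s : ℕ} {E : ι → Finset Y}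

/-- Two members with two common points cover at most `2 * q` points, so they have the same index. -/
theorem eq_of_mem (hE : LocallySparse q s E) (hs : 2 ≤ s) (hq : ∀ i, (E i).card ≤ q + 1)
    {i j : ι} {x y : Y} (hxy : x ≠ y) (hxi : x ∈ E i) (hyi : y ∈ E i) (hxj : x ∈ E j)
    (hyj : y ∈ E j) : i = j := by
  classical
  by_contra hij
  have h := hE {i, j} (by simp) (by rw [Finset.card_pair hij]; exact hs)
  rw [Finset.card_pair hij, Finset.biUnion_insert, Finset.singleton_biUnion] at h
  have h1 := Finset.card_union_add_card_inter (E i) (E j)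
  have h2 : ({x, y} : Finset Y).card ≤ (E i ∩ E j).card :=
    Finset.card_le_card (by intro z; simp; rintro (rfl | rfl) <;> simp [*])
  rw [Finset.card_pair hxy] at h2
  have := hq i
  have := hq j
  lia

/-- Members of `E` chosen along the steps of a walk form a connected family, so each new one adds at
most `q` points to those already covered. The starting vertex is inserted only for the sake of the
walk of length zero, whose family is empty. -/
theorem exists_finset_of_walk {G : SimpleGraph Y} (hq : ∀ i, (E i).card ≤ q + 1)
    (hG : ∀ x y, G.Adj x y → ∃ i, x ∈ E i ∧ y ∈ E i) {u v : Y} (p : G.Walk u v) :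
    ∃ T : Finset ι, T.card ≤ p.length ∧
      (∀ i ∈ T, ∃ d ∈ p.darts, d.fst ∈ E i ∧ d.snd ∈ E i) ∧
      (insert u (T.biUnion E)).card ≤ q * T.card + 1 ∧ v ∈ insert u (T.biUnion E) := by
  classical
  induction p with
  | nil => exact ⟨∅, by simp⟩
  | @cons u w v h p ih =>
    obtain ⟨T, hT, hd, hc, hv⟩ := ih
    obtain ⟨i, hui, hwi⟩ := hG u w h
    have hsub : insert u ((insert i T).biUnion E) ⊆ insert w (T.biUnion E) ∪ (E i).erase w := by
      rw [Finset.biUnion_insert]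
      intro x
      simp only [Finset.mem_insert, Finset.mem_union, Finset.mem_erase]
      rintro (rfl | h | h) <;> tauto
    refine ⟨insert i T, ?_, ?_, ?_, ?_⟩
    · rw [SimpleGraph.Walk.length_cons]
      exact (Finset.card_insert_le _ _).trans (by lia)
    · intro j hj
      rcases Finset.mem_insert.mp hj with rfl | hj
      · exact ⟨⟨(u, w), h⟩, by simp, hui, hwi⟩
      · obtain ⟨d, hd1, hd2⟩ := hd j hj
        exact ⟨d, by simp [hd1], hd2⟩
    · by_cases hi : i ∈ T
      · rw [Finset.insert_eq_of_mem hi, Finset.insert_eq_of_mem]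
        · exact (Finset.card_le_card (Finset.subset_insert _ _)).trans hc
        · exact Finset.mem_biUnion.mpr ⟨i, hi, hui⟩
      · have h1 := (Finset.card_le_card hsub).trans (Finset.card_union_le _ _)
        rw [Finset.card_erase_of_mem hwi] at h1
        have := hq i
        rw [Finset.card_insert_of_notMem hi]
        lia
    · rw [Finset.biUnion_insert]
      rcases Finset.mem_insert.mp hv with rfl | hv
      · simp [hwi]
      · exact Finset.mem_insert_of_mem (Finset.mem_union_right _ hv)

/-- If no step of the walk lay in `E i`, then adding `E i`, which contains both ends of the walk, to
the family of `exists_finset_of_walk` would add at most `q - 1` points and contradict sparsity. -/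
theorem exists_dart_of_walk (hE : LocallySparse q s E) {G : SimpleGraph Y}
    (hq : ∀ i, (E i).card ≤ q + 1) (hG : ∀ x y, G.Adj x y → ∃ i, x ∈ E i ∧ y ∈ E i) {u v : Y}
    (p : G.Walk u v) (hp : p.length < s) (huv : u ≠ v) {i : ι} (hu : u ∈ E i) (hv : v ∈ E i) :
    ∃ d ∈ p.darts, d.fst ∈ E i ∧ d.snd ∈ E i := by
  classical
  obtain ⟨T, hT, hd, hc, hvT⟩ := exists_finset_of_walk hq hG p
  by_contra hcon
  have hi : i ∉ T := fun hi => hcon (hd i hi)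
  have h := hE (insert i T) (by simp) (by rw [Finset.card_insert_of_notMem hi]; lia)
  have hsub : (insert i T).biUnion E ⊆ insert u (T.biUnion E) ∪ ((E i).erase u).erase v := by
    rw [Finset.biUnion_insert]
    intro x
    rw [Finset.mem_insert] at hvT
    simp only [Finset.mem_insert, Finset.mem_union, Finset.mem_erase]
    by_cases h1 : x = u
    · tauto
    by_cases h2 : x = v
    · subst h2; tauto
    tauto
  have h1 := (Finset.card_le_card hsub).trans (Finset.card_union_le _ _)
  rw [Finset.card_erase_of_mem (Finset.mem_erase.mpr ⟨huv.symm, hv⟩),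
    Finset.card_erase_of_mem hu] at h1
  have h2 : 2 ≤ (E i).card := Finset.one_lt_card.mpr ⟨u, hu, v, hv, huv⟩
  have := hq i
  rw [Finset.card_insert_of_notMem hi] at h
  lia

/-- A short path with both ends in `E i` stays in `E i`: some step of it lies in `E i`, and the two
pieces of the path before and after that step are shorter. -/
theorem support_subset_of_isPath (hE : LocallySparse q s E) {G : SimpleGraph Y}
    (hq : ∀ i, (E i).card ≤ q + 1) (hG : ∀ x y, G.Adj x y → ∃ i, x ∈ E i ∧ y ∈ E i) {i : ι}
    {u v : Y} (p : G.Walk u v) (hpath : p.IsPath) (hp : p.length < s)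
    (hu : u ∈ E i) (hv : v ∈ E i) : ∀ x ∈ p.support, x ∈ E i := by
  induction hn : p.length using Nat.strong_induction_on generalizing u v with
  | _ n ih =>
    by_cases huv : u = v
    · subst huv
      rw [SimpleGraph.Walk.isPath_iff_nil] at hpath
      obtain rfl := hpath.eq_nil
      simpa using hu
    obtain ⟨d, hd, h1, h2⟩ := hE.exists_dart_of_walk hq hG p hp huv hu hv
    rw [← SimpleGraph.Walk.isSubwalk_toWalk_adj_iff_mem_darts] at hd
    obtain ⟨a, b, rfl⟩ := hd
    have hb := hpath.of_append_right
    have ha := hpath.of_append_left.of_append_left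
    simp only [SimpleGraph.Walk.length_append, SimpleGraph.Walk.length_cons,
      SimpleGraph.Walk.length_nil, SimpleGraph.Adj.toWalk] at hn hp
    have iha := ih _ (by lia) a ha (by lia) hu h1 rfl
    have ihb := ih _ (by lia) b hb (by lia) h2 hv rfl
    intro x
    simp only [SimpleGraph.Walk.mem_support_append_iff, SimpleGraph.Adj.toWalk,
      SimpleGraph.Walk.support_cons, SimpleGraph.Walk.support_nil, List.mem_cons]
    rintro ((h | rfl | rfl | h) | h)
    · exact iha x h
    · exact h1
    · exact h2
    · simp at h
    · exact ihb x h

end LocallySparse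

/-! ### Colorings without a copy of `H` in a class -/

section Coloring

open SimpleGraph

variable {V W Y : Type*}

theorem IsHColorable.of_isContained {H : SimpleGraph V} {G : SimpleGraph W} {G' : SimpleGraph Y}
    {k : ℕ} (h : IsHColorable H G k) (hG : G' ⊑ G) : IsHColorable H G' k := by
  obtain ⟨c, hc⟩ := h
  obtain ⟨f⟩ := hG
  refine ⟨c ∘ f, fun i hi => hc i (hi.trans ⟨⟨⟨fun x => ⟨f x.1, x.2⟩, ?_⟩, ?_⟩⟩)⟩
  · intro a b hab
    exact f.toHom.map_adj hab
  · intro a b hab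
    exact Subtype.ext (f.injective (congrArg Subtype.val hab))

theorem IsHColorable.mono {H : SimpleGraph V} {G : SimpleGraph W} {k l : ℕ} [Nonempty V]
    (h : IsHColorable H G k) (hkl : k ≤ l) : IsHColorable H G l := by
  obtain ⟨c, hc⟩ := h
  refine ⟨fun x => Fin.castLE hkl (c x), fun i hi => ?_⟩
  obtain ⟨f⟩ := hi
  obtain ⟨v⟩ := ‹Nonempty V›
  refine hc (c (f v).1) ⟨⟨⟨fun x => ⟨(f x).1, ?_⟩, ?_⟩, ?_⟩⟩
  · exact Fin.castLE_injective hkl ((f x).2.trans (f v).2.symm)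
  · intro a b hab
    exact f.toHom.map_adj hab
  · intro a b hab
    exact f.injective (Subtype.ext (congrArg (fun z => z.1) hab))

theorem isHColorable_of_isEmpty [Nonempty V] [IsEmpty W] (H : SimpleGraph V) (G : SimpleGraph W)
    (k : ℕ) : IsHColorable H G k :=
  ⟨isEmptyElim, fun _ ⟨f⟩ => isEmptyElim (f (Classical.arbitrary V)).1⟩

/-- The vertex `x` gets a class of its own, which is too small to contain `H`. -/
theorem isHColorable_succ_of_diff [Nontrivial V] {H : SimpleGraph V} {G : SimpleGraph W}
    {S : Set W} {x : W} {k : ℕ} (h : IsHColorable H (G.induce (S \ {x})) k) :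
    IsHColorable H (G.induce S) (k + 1) := by
  classical
  obtain ⟨c, hc⟩ := h
  refine ⟨fun y => if hy : y.1 = x then Fin.last k else (c ⟨y.1, y.2, hy⟩).castSucc,
    fun i ⟨f⟩ => ?_⟩
  induction i using Fin.lastCases with
  | last =>
    have key : ∀ v, (f v).1.1 = x := by
      intro v
      by_contra hv
      have := (f v).2
      simp only [Set.mem_ofPred_eq, dif_neg hv] at this
      exact (Fin.castSucc_lt_last _).ne this
    obtain ⟨a, b, hab⟩ := exists_pair_ne V
    exact hab (f.injective (Subtype.ext (Subtype.ext ((key a).trans (key b).symm))))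
  | cast i =>
    have key : ∀ v, ∃ hv : (f v).1.1 ≠ x, c ⟨(f v).1.1, (f v).1.2, hv⟩ = i := by
      intro v
      have := (f v).2
      by_cases hv : (f v).1.1 = x
      · simp only [Set.mem_ofPred_eq, dif_pos hv] at this
        exact absurd this.symm (Fin.castSucc_lt_last _).ne
      · simp only [Set.mem_ofPred_eq, dif_neg hv] at this
        exact ⟨hv, Fin.castSucc_injective _ this⟩
    refine hc i ⟨⟨⟨fun v => ⟨⟨(f v).1.1, (f v).1.2, (key v).1⟩, (key v).2⟩, ?_⟩, ?_⟩⟩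
    · intro a b hab
      exact f.toHom.map_adj hab
    · intro a b hab
      exact f.injective (Subtype.ext (Subtype.ext (congrArg (fun z => z.1.1) hab)))

theorem hChromaticNumber_eq_succ [Nonempty V] {H : SimpleGraph V} {G : SimpleGraph W} {k : ℕ}
    (h : IsHColorable H G (k + 1)) (h' : ¬ IsHColorable H G k) :
    hChromaticNumber H G = ((k + 1 : ℕ) : ℕ∞) := by
  refine le_antisymm (iInf₂_le (k + 1) h) (le_iInf₂ fun l hl => ?_)
  have : k < l := by
    by_contra! hlk
    exact h' (IsHColorable.mono hl hlk)
  exact_mod_cast this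

/-- Removing a vertex lowers the `H`-chromatic number by at most one, so a minimal vertex set whose
induced subgraph is not `H`-colorable with `k` classes has `H`-chromatic number exactly `k + 1`. -/
theorem exists_hChromaticNumber_eq_succ [Nontrivial V] [Finite W] {H : SimpleGraph V}
    {G : SimpleGraph W} {k : ℕ} (h : ¬ IsHColorable H G k) :
    ∃ (n : ℕ) (G' : SimpleGraph (Fin n)), G' ⊑ G ∧
      hChromaticNumber H G' = ((k + 1 : ℕ) : ℕ∞) := by
  have hex : ∃ S : Set W, ¬ IsHColorable H (G.induce S) k :=
    ⟨Set.univ, fun h1 => h (h1.of_isContained ⟨(induceUnivIso G).symm.toCopy⟩)⟩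
  obtain ⟨S, hS⟩ := exists_minimal_of_wellFoundedLT
    (fun S : Set W => ¬ IsHColorable H (G.induce S) k) hex
  obtain ⟨x, hx⟩ : S.Nonempty := by
    by_contra! hempty
    subst hempty
    exact hS.1 (isHColorable_of_isEmpty _ _ _)
  have hdiff : IsHColorable H (G.induce (S \ {x})) k := by
    by_contra hcon
    exact (hS.2 hcon Set.sdiff_subset hx).2 rfl
  obtain ⟨n, ⟨e⟩⟩ := Finite.exists_equiv_fin S
  have φ := Iso.map e (G.induce S)
  refine ⟨n, (G.induce S).map e, ⟨(Embedding.induce S).toCopy.comp φ.symm.toCopy⟩, ?_⟩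
  exact hChromaticNumber_eq_succ ((isHColorable_succ_of_diff hdiff).of_isContained ⟨φ.symm.toCopy⟩)
    fun h1 => hS.1 (h1.of_isContained ⟨φ.toCopy⟩)

/-- The cycle through all of `cycleGraph m` has to lie in a single copy of `H`, so `H` has a cycle
of length `m`. -/
theorem IsHForest.egirth_le {H : SimpleGraph V} {m : ℕ} (hm : 3 ≤ m)
    (h : IsHForest H (cycleGraph m)) : H.egirth ≤ m := by
  obtain ⟨N, U, C, f, hC, -, -, hcyc⟩ := h
  obtain ⟨v, p, hp, hlen⟩ := (cycleGraph_isContained_iff hm).mp (IsContained.refl (cycleGraph m))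
  obtain ⟨K, hK, hle⟩ := hcyc v p hp
  obtain ⟨φ⟩ := hC K hK
  set p' := p.map f.toHom
  have hp' : p'.IsCycle := hp.map f.injective
  have hedge : ∀ e ∈ p'.edges, e ∈ K.spanningCoe.edgeSet := by
    intro e he
    rw [Subgraph.edgeSet_spanningCoe]
    exact Subgraph.edgeSet_mono hle (by simpa using he)
  have hcont : cycleGraph m ⊑ K.spanningCoe :=
    (cycleGraph_isContained_iff hm).mpr ⟨_, _, hp'.transfer hedge, by simp [p', hlen]⟩
  obtain ⟨g⟩ := hcont
  -- `K.spanningCoe` has all vertices of `U`; a vertex with a neighbour in it is a vertex of `K`.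
  have hverts : ∀ x, g x ∈ K.verts := by
    intro x
    have : Nontrivial (Fin m) := Fin.nontrivial_iff_two_le.mpr (by lia)
    obtain ⟨y, hy⟩ := (cycleGraph_preconnected (n := m)).exists_adj_of_nontrivial x
    exact K.edge_vert (g.toHom.map_adj hy)
  have hcoe : cycleGraph m ⊑ K.coe :=
    ⟨⟨⟨fun x => ⟨g x, hverts x⟩, fun {a b} hab => g.toHom.map_adj hab⟩,
      fun a b hab => g.injective (congrArg Subtype.val hab)⟩⟩
  obtain ⟨w, r, hr, hrl⟩ := (cycleGraph_isContained_iff hm).mp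
    (hcoe.trans ⟨φ.symm.toCopy⟩)
  rw [← hrl]
  exact egirth_le_length hr

end Coloring

/-! ### Copies of `H` placed on the hyperedges of a hypergraph -/

section HyperedgeGraph

open SimpleGraph

variable {V W Y ι : Type*}

/-- The union of copies of `H`, one on each hyperedge: the vertex set of `H` is placed on the `i`-th
hyperedge by the embedding `e i`. -/
def hyperedgeGraph (H : SimpleGraph V) (e : ι → V ↪ Y) : SimpleGraph Y := ⨆ i, H.map (e i)

theorem hyperedgeGraph_adj {H : SimpleGraph V} {e : ι → V ↪ Y} {x y : Y} :
    (hyperedgeGraph H e).Adj x y ↔ ∃ i a b, H.Adj a b ∧ e i a = x ∧ e i b = y := by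
  simp [hyperedgeGraph, SimpleGraph.iSup_adj, SimpleGraph.map_adj]

/-- The copy of `H` on the `i`-th hyperedge. -/
def hyperedgeCopy (H : SimpleGraph V) (e : ι → V ↪ Y) (i : ι) : Copy H (hyperedgeGraph H e) :=
  ⟨⟨e i, fun {a b} hab => hyperedgeGraph_adj.mpr ⟨i, a, b, hab, rfl, rfl⟩⟩, (e i).injective⟩

theorem hyperedgeCopy_toSubgraph_adj {H : SimpleGraph V} {e : ι → V ↪ Y} {i : ι} {x y : Y} :
    (hyperedgeCopy H e i).toSubgraph.Adj x y ↔ ∃ a b, H.Adj a b ∧ e i a = x ∧ e i b = y := by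
  simp [hyperedgeCopy, Relation.Map]

theorem mem_verts_hyperedgeCopy {H : SimpleGraph V} {e : ι → V ↪ Y} {i : ι} {x : Y} :
    x ∈ (hyperedgeCopy H e i).toSubgraph.verts ↔ ∃ a, e i a = x := by
  simp [hyperedgeCopy]

/-- A monochromatic hyperedge gives a copy of `H` inside a color class. -/
theorem not_isHColorable_hyperedgeGraph [Nonempty V] (H : SimpleGraph V) {e : ι → V ↪ Y} {k : ℕ}
    (he : ∀ c : Y → Fin k, ∃ i, ∀ a b, c (e i a) = c (e i b)) :
    ¬ IsHColorable H (hyperedgeGraph H e) k := by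
  rintro ⟨c, hc⟩
  obtain ⟨i, hi⟩ := he c
  obtain ⟨v⟩ := ‹Nonempty V›
  refine hc (c (e i v)) ⟨⟨⟨fun a => ⟨e i a, hi a v⟩, ?_⟩, ?_⟩⟩
  · intro a b hab
    exact (hyperedgeCopy H e i).toHom.map_adj hab
  · intro a b hab
    exact (e i).injective (congrArg Subtype.val hab)

/-- Local sparsity up to the size of `F` makes every subgraph `F` of the union of copies an
`H`-forest. The condition `hcov` is needed because an `H`-forest has all its vertices in the copies. -/
theorem isHForest_of_isContained_hyperedgeGraph [Fintype V] [Finite W] {H : SimpleGraph V}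
    {F : SimpleGraph W} {N q s : ℕ} {e : ι → V ↪ Fin N} (hq : Fintype.card V = q + 1)
    (hs : 2 ≤ s) (hW : Nat.card W ≤ s)
    (he : LocallySparse q s fun i => Finset.univ.map (e i)) (hcov : ∀ y, ∃ i a, e i a = y)
    (hF : F ⊑ hyperedgeGraph H e) : IsHForest H F := by
  classical
  have := Fintype.ofFinite W
  rw [Nat.card_eq_fintype_card] at hW
  obtain ⟨f⟩ := hF
  have hcard : ∀ i, (Finset.univ.map (e i)).card ≤ q + 1 := by simp [hq]
  have hadj : ∀ x y, (hyperedgeGraph H e).Adj x y →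
      ∃ i, x ∈ Finset.univ.map (e i) ∧ y ∈ Finset.univ.map (e i) := by
    intro x y hxy
    obtain ⟨i, a, b, -, rfl, rfl⟩ := hyperedgeGraph_adj.mp hxy
    exact ⟨i, by simp⟩
  refine ⟨N, hyperedgeGraph H e, Set.range fun i => (hyperedgeCopy H e i).toSubgraph, f,
    ?_, ?_, ?_, ?_⟩
  · rintro _ ⟨i, rfl⟩
    exact ⟨(hyperedgeCopy H e i).isoToSubgraph⟩
  · rintro _ ⟨i, rfl⟩ _ ⟨j, rfl⟩ hij x ⟨hxi, hxj⟩ y ⟨hyi, hyj⟩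
    by_contra hxy
    refine hij ?_
    rw [mem_verts_hyperedgeCopy] at hxi hxj hyi hyj
    rw [he.eq_of_mem hs hcard (i := i) (j := j) hxy (by simpa) (by simpa) (by simpa) (by simpa)]
  · constructor
    · intro x _
      obtain ⟨i, a, hx⟩ := hcov x
      rw [Subgraph.verts_sSup]
      exact Set.mem_biUnion (Set.mem_range_self i) (mem_verts_hyperedgeCopy.mpr ⟨a, hx⟩)
    · intro x y hxy
      obtain ⟨i, hi⟩ := hyperedgeGraph_adj.mp (f.toSubgraph.adj_sub hxy)
      exact Subgraph.sSup_adj.mpr ⟨_, Set.mem_range_self i, hyperedgeCopy_toSubgraph_adj.mpr hi⟩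
  · intro v p hp
    cases p with
    | nil => exact absurd hp Walk.not_isCycle_nil
    | @cons _ w _ h p =>
      -- The ends of the path `p` are joined by the edge `h`, so they lie on a common hyperedge,
      -- which then contains all of `p`.
      have hpath := ((Walk.cons_isCycle_iff _ _).mp hp).1
      obtain ⟨i, hi⟩ := hadj _ _ (f.toHom.map_adj h)
      have hsupp := he.support_subset_of_isPath hcard hadj (p.map f.toHom)
        (hpath.map f.injective)
        (by rw [Walk.length_map]; exact hpath.length_lt.trans_le hW) hi.2 hi.1
      have hsupp' : ∀ x ∈ ((Walk.cons h p).map f.toHom).support, x ∈ Finset.univ.map (e i) := by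
        intro x hx
        rw [Walk.map_cons, Walk.support_cons, List.mem_cons] at hx
        rcases hx with rfl | hx
        · exact hi.1
        · exact hsupp x hx
      refine ⟨_, Set.mem_range_self i, ?_, ?_⟩
      · intro x hx
        rw [Walk.mem_verts_toSubgraph] at hx
        exact mem_verts_hyperedgeCopy.mpr (by simpa using hsupp' x hx)
      · -- Sharing two points with hyperedge `i`, the copy that contributes the edge is the `i`-th.
        intro x y hxy
        have hx := hsupp' x ((Walk.mem_verts_toSubgraph _).mp (Subgraph.edge_vert _ hxy))
        have hy := hsupp' y ((Walk.mem_verts_toSubgraph _).mp (Subgraph.edge_vert _ hxy.symm))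
        have hxy' := Subgraph.adj_sub _ hxy
        obtain ⟨j, a, b, hab, rfl, rfl⟩ := hyperedgeGraph_adj.mp hxy'
        obtain rfl := he.eq_of_mem hs hcard (i := i) (j := j) hxy'.ne hx hy (by simp) (by simp)
        exact hyperedgeCopy_toSubgraph_adj.mpr ⟨a, b, hab, rfl, rfl⟩

end HyperedgeGraph

/-! ### Sparse hypergraphs of large chromatic number -/

section RandomHypergraph

open Finset

theorem exists_subset_image_fin {X : Type*} [DecidableEq X] [Nonempty X] {U : Finset X}
    {m : ℕ} (h : U.card ≤ m) : ∃ g : Fin m → X, U ⊆ univ.image g := by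
  obtain ⟨φ⟩ : Nonempty (U ↪ Fin m) :=
    Function.Embedding.nonempty_of_card_le (by simpa using h)
  refine ⟨Function.extend φ Subtype.val fun _ => Classical.arbitrary X, fun x hx => ?_⟩
  exact mem_image.mpr ⟨φ ⟨x, hx⟩, mem_univ _, φ.injective.extend_apply _ _ _⟩

section Counting

variable {V X : Type*} [Fintype V]

/-- The number of systems `ω` of `M` tuples for which those indexed by `T` cover at most `m` points:
there are `|X| ^ m` ways to choose a sequence of `m` points that contains them all, then at most
`m ^ |V|` ways for each tuple in `T` and `|X| ^ |V|` for each of the others. -/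
theorem card_filter_card_biUnion_le [Fintype X] [DecidableEq V] [DecidableEq X] [Nonempty X]
    {M : ℕ} (T : Finset (Fin M)) (m : ℕ) :
    #{ω : Fin M → V → X | #(T.biUnion fun i => univ.image (ω i)) ≤ m} ≤
      Fintype.card X ^ m *
        ((m ^ Fintype.card V) ^ #T * (Fintype.card X ^ Fintype.card V) ^ (M - #T)) := by
  have hsub : ({ω : Fin M → V → X | #(T.biUnion fun i => univ.image (ω i)) ≤ m} : Finset _) ⊆
      (univ : Finset (Fin m → X)).biUnion fun g => Fintype.piFinset fun i =>
        if i ∈ T then Fintype.piFinset fun _ : V => univ.image g else univ := by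
    intro ω hω
    obtain ⟨g, hg⟩ := exists_subset_image_fin (mem_filter.mp hω).2
    refine mem_biUnion.mpr ⟨g, mem_univ _, Fintype.mem_piFinset.mpr fun i => ?_⟩
    split_ifs with hi
    · exact Fintype.mem_piFinset.mpr fun a =>
        hg (mem_biUnion.mpr ⟨i, hi, mem_image_of_mem _ (mem_univ a)⟩)
    · exact mem_univ _
  refine (card_le_card hsub).trans ((card_biUnion_le_card_mul _ _ _ fun g _ => ?_).trans_eq
    (by rw [card_univ, Fintype.card_fun, Fintype.card_fin]))
  rw [Fintype.card_piFinset]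
  have h1 : ∀ i : Fin M, #(if i ∈ T then Fintype.piFinset fun _ : V => univ.image g else univ) ≤
      if i ∈ T then m ^ Fintype.card V else Fintype.card X ^ Fintype.card V := by
    intro i
    split_ifs
    · rw [Fintype.card_piFinset, prod_const, card_univ]
      gcongr
      exact card_image_le.trans_eq (by simp)
    · simp
  refine (prod_le_prod' fun i _ => h1 i).trans_eq ?_
  rw [prod_ite, prod_const, prod_const, filter_mem_eq_inter, univ_inter, filter_notMem_eq_sdiff,
    card_sdiff_of_subset (subset_univ _), card_univ, Fintype.card_fin]

/-- The sets of at least `1` and at most `s` indices that violate local sparsity for the ranges of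
the tuples `ω i`. -/
def denseSubfamilies [DecidableEq X] (q s : ℕ) {M : ℕ} (ω : Fin M → V → X) :
    Finset (Finset (Fin M)) :=
  (Icc 1 s).biUnion fun t =>
    {T ∈ powersetCard t univ | #(T.biUnion fun i => univ.image (ω i)) ≤ q * t}

theorem mem_denseSubfamilies [DecidableEq X] {q s M : ℕ} {ω : Fin M → V → X} {T : Finset (Fin M)} :
    T ∈ denseSubfamilies q s ω ↔
      T.Nonempty ∧ #T ≤ s ∧ #(T.biUnion fun i => univ.image (ω i)) ≤ q * #T := by
  simp only [denseSubfamilies, mem_biUnion, mem_Icc, mem_filter, mem_powersetCard, subset_univ,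
    true_and, ← card_pos]
  constructor
  · rintro ⟨_, h, rfl, h'⟩
    exact ⟨h.1, h.2, h'⟩
  · rintro ⟨h1, h2, h3⟩
    exact ⟨_, ⟨h1, h2⟩, rfl, h3⟩

/-- With `A * |X|` random tuples the expected number of violations of local sparsity is bounded by a
constant independent of `|X|`: for sets of `t` indices the factor `|X| ^ t` from the choice of the
set cancels the probability, which is of order `|X| ^ (q * t - (q + 1) * t)`. -/
theorem sum_card_denseSubfamilies_le [Fintype X] [DecidableEq V] [DecidableEq X] [Nonempty X]
    {q : ℕ} (hq : Fintype.card V = q + 1) (s A : ℕ) :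
    ∑ ω : Fin (A * Fintype.card X) → V → X, #(denseSubfamilies q s ω) ≤
      (∑ t ∈ Icc 1 s, A ^ t * ((q * t) ^ (q + 1)) ^ t) *
        (Fintype.card X ^ (q + 1)) ^ (A * Fintype.card X) := by
  set n := Fintype.card X
  set M := A * n with hM
  calc
    _ ≤ ∑ ω : Fin M → V → X, ∑ t ∈ Icc 1 s,
          #{T ∈ powersetCard t univ | #(T.biUnion fun i => univ.image (ω i)) ≤ q * t} :=
      sum_le_sum fun ω _ => card_biUnion_le
    _ = ∑ t ∈ Icc 1 s, ∑ T ∈ powersetCard t univ,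
          #{ω : Fin M → V → X | #(T.biUnion fun i => univ.image (ω i)) ≤ q * t} := by
      rw [sum_comm]
      refine sum_congr rfl fun t _ => ?_
      exact sum_card_bipartiteAbove_eq_sum_card_bipartiteBelow _
    _ ≤ _ := by
      rw [sum_mul]
      refine sum_le_sum fun t ht => ?_
      refine (sum_le_card_nsmul _ _ (n ^ (q * t) * (((q * t) ^ (q + 1)) ^ t *
        (n ^ (q + 1)) ^ (M - t))) fun T hT => ?_).trans ?_
      · have := card_filter_card_biUnion_le (V := V) (X := X) T (q * t)
        rwa [(mem_powersetCard.mp hT).2, hq] at this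
      · rw [card_powersetCard, card_univ, Fintype.card_fin, smul_eq_mul]
        rcases lt_or_ge M t with htM | htM
        · simp [Nat.choose_eq_zero_of_lt htM]
        · calc
            _ ≤ M ^ t * (n ^ (q * t) * (((q * t) ^ (q + 1)) ^ t * (n ^ (q + 1)) ^ (M - t))) := by
              gcongr
              exact Nat.choose_le_pow M t
            _ = A ^ t * ((q * t) ^ (q + 1)) ^ t *
                  ((n ^ t * n ^ (q * t)) * (n ^ (q + 1)) ^ (M - t)) := by
              rw [hM, mul_pow]; ring
            _ = _ := by
              congr 1
              rw [← pow_add, ← pow_mul, ← pow_mul, ← pow_add]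
              congr 1
              obtain ⟨d, hd⟩ := Nat.exists_eq_add_of_le htM
              rw [hd, Nat.add_sub_cancel_left]
              ring

/-- The exponential moment of the number of monochromatic tuples of a coloring. By pigeonhole a
tuple is monochromatic with probability at least `1 / k ^ |V|`, and the tuples are independent. -/
theorem sum_half_pow_card_le [Fintype X] [DecidableEq V] {k N M : ℕ} (hk : 0 < k)
    (hX : Fintype.card X = k * N) (c : X → Fin k) :
    ∑ ω : Fin M → V → X, (1 / 2 : ℝ) ^ #{i | ∀ a b, c (ω i a) = c (ω i b)} ≤
      (((Fintype.card X : ℝ) ^ Fintype.card V) * (1 - 1 / (2 * (k : ℝ) ^ Fintype.card V))) ^ M := by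
  have hprod : ∀ ω : Fin M → V → X, (1 / 2 : ℝ) ^ #{i | ∀ a b, c (ω i a) = c (ω i b)} =
      ∏ i, if ∀ a b, c (ω i a) = c (ω i b) then (1 / 2 : ℝ) else 1 := by
    intro ω
    rw [prod_ite, prod_const, prod_const_one, mul_one]
  simp_rw [hprod]
  rw [← Fintype.sum_pow (fun f : V → X => if ∀ a b, c (f a) = c (f b) then (1 / 2 : ℝ) else 1) M]
  refine pow_le_pow_left₀ (sum_nonneg fun f _ => by split_ifs <;> norm_num) ?_ M
  obtain ⟨j, -, hj⟩ := exists_le_card_fiber_of_mul_le_card_of_maps_to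
    (s := (univ : Finset X)) (t := (univ : Finset (Fin k))) (f := c) (n := N)
    (fun _ _ => mem_univ _) ⟨⟨0, hk⟩, mem_univ _⟩ (by simp [hX])
  have hmono : N ^ Fintype.card V ≤ #{f : V → X | ∀ a b, c (f a) = c (f b)} := by
    calc
      _ ≤ #{x | c x = j} ^ Fintype.card V := by gcongr
      _ = #(Fintype.piFinset fun _ : V => ({x | c x = j} : Finset X)) := by
        rw [Fintype.card_piFinset, prod_const, card_univ]
      _ ≤ _ := by
        refine card_le_card fun f hf => mem_filter.mpr ⟨mem_univ _, fun a b => ?_⟩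
        have hf := Fintype.mem_piFinset.mp hf
        exact (mem_filter.mp (hf a)).2.trans (mem_filter.mp (hf b)).2.symm
  have hmono' : (N : ℝ) ^ Fintype.card V ≤ #{f : V → X | ∀ a b, c (f a) = c (f b)} := by
    exact_mod_cast hmono
  have hsum : ∀ f : V → X, (if ∀ a b, c (f a) = c (f b) then (1 / 2 : ℝ) else 1) =
      1 - 1 / 2 * if ∀ a b, c (f a) = c (f b) then (1 : ℝ) else 0 := by
    intro f
    split_ifs <;> norm_num
  simp_rw [hsum]
  rw [sum_sub_distrib, ← mul_sum, sum_boole, sum_const, card_univ, Fintype.card_fun, hX]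
  have hk' : (0 : ℝ) < (k : ℝ) ^ Fintype.card V := by positivity
  have : ((k * N : ℕ) : ℝ) ^ Fintype.card V * (1 - 1 / (2 * (k : ℝ) ^ Fintype.card V)) =
      ((k * N : ℕ) : ℝ) ^ Fintype.card V - 1 / 2 * (N : ℝ) ^ Fintype.card V := by
    push_cast
    rw [mul_pow]
    field_simp
  rw [this, nsmul_eq_mul, mul_one]
  push_cast
  linarith

end Counting

variable {V : Type*} [Fintype V]

/-- Some system of tuples has, for every coloring, more monochromatic tuples than violations of
local sparsity. -/
theorem exists_few_denseSubfamilies_many_monochromatic [DecidableEq V] {q k : ℕ}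
    (hq : Fintype.card V = q + 1) (hk : 0 < k) (s : ℕ) :
    ∃ (n M : ℕ) (ω : Fin M → V → Fin n), ∀ c : Fin n → Fin k,
      #(denseSubfamilies q s ω) < #{i | ∀ a b, c (ω i a) = c (ω i b)} := by
  have hk' : (0 : ℝ) < k := by exact_mod_cast hk
  have hk1 : (1 : ℝ) ≤ k := by exact_mod_cast hk
  set β : ℝ := 1 - 1 / (2 * (k : ℝ) ^ (q + 1)) with hβ
  have hβ0 : 0 ≤ β := by
    have : 1 / (2 * (k : ℝ) ^ (q + 1)) ≤ 1 := by
      rw [div_le_one (by positivity)]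
      linarith [one_le_pow₀ hk1 (n := q + 1)]
    linarith
  have hβ1 : β < 1 := by
    have : 0 < 1 / (2 * (k : ℝ) ^ (q + 1)) := by positivity
    linarith
  -- With `A` tuples per point, the decay of the exponential moment beats the number `k ^ n` of
  -- colorings by a factor `2 ^ n`.
  obtain ⟨A, hA⟩ := exists_pow_lt_of_lt_one (show (0 : ℝ) < 1 / (2 * k) by positivity) hβ1
  have hA' : (k : ℝ) * β ^ A ≤ 1 / 2 := by
    calc
      _ ≤ (k : ℝ) * (1 / (2 * k)) := by gcongr
      _ = 1 / 2 := by field_simp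
  set C := ∑ t ∈ Icc 1 s, A ^ t * ((q * t) ^ (q + 1)) ^ t with hC
  set n := k * (2 * C + 2) with hn
  have hn2 : 2 * C + 2 ≤ n := Nat.le_mul_of_pos_left _ hk
  have : NeZero n := ⟨by lia⟩
  refine ⟨n, A * n, ?_⟩
  by_contra! hcon
  have hbad := sum_card_denseSubfamilies_le (X := Fin n) hq s A
  rw [Fintype.card_fin, ← hC] at hbad
  set P : ℝ := ((n : ℝ) ^ (q + 1)) ^ (A * n) with hP
  have hn0 : (0 : ℝ) < n := by exact_mod_cast (NeZero.pos n)
  have hP0 : 0 < P := by positivity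
  have hbad' : ∑ ω : Fin (A * n) → V → Fin n, (#(denseSubfamilies q s ω) : ℝ) ≤ C * P := by
    rw [hP]
    exact_mod_cast hbad
  have hmono : ∀ c : Fin n → Fin k, ∑ ω : Fin (A * n) → V → Fin n,
      (1 / 2 : ℝ) ^ #{i | ∀ a b, c (ω i a) = c (ω i b)} ≤ P * (β ^ A) ^ n := by
    intro c
    refine (sum_half_pow_card_le (N := 2 * C + 2) hk (by simp [hn]) c).trans_eq ?_
    rw [Fintype.card_fin, hq, mul_pow, ← hβ, pow_mul β]
  -- Markov's inequality: either there are more than `2 * C` violations, or some coloring has at most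
  -- `2 * C` monochromatic tuples. The first summand is at least `1` in the first case and the second
  -- summand in the second case, but their means are at most `1 / 2` and `1 / 4`.
  have hone : ∀ ω : Fin (A * n) → V → Fin n, (1 : ℝ) ≤
      (#(denseSubfamilies q s ω) : ℝ) / (2 * C + 1) +
        2 ^ (2 * C) * ∑ c : Fin n → Fin k, (1 / 2 : ℝ) ^ #{i | ∀ a b, c (ω i a) = c (ω i b)} := by
    intro ω
    rcases Nat.lt_or_ge (2 * C) #(denseSubfamilies q s ω) with h | h
    · have : (1 : ℝ) ≤ (#(denseSubfamilies q s ω) : ℝ) / (2 * C + 1) := by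
        rw [one_le_div (by positivity)]
        exact_mod_cast h
      have : 0 ≤ 2 ^ (2 * C) *
          ∑ c : Fin n → Fin k, (1 / 2 : ℝ) ^ #{i | ∀ a b, c (ω i a) = c (ω i b)} := by positivity
      linarith
    · obtain ⟨c, hc⟩ := hcon ω
      have h1 : (1 / 2 : ℝ) ^ (2 * C) ≤
          ∑ c : Fin n → Fin k, (1 / 2 : ℝ) ^ #{i | ∀ a b, c (ω i a) = c (ω i b)} :=
        (pow_le_pow_of_le_one (by norm_num) (by norm_num) (hc.trans h)).trans
          (single_le_sum (f := fun c : Fin n → Fin k =>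
            (1 / 2 : ℝ) ^ #{i | ∀ a b, c (ω i a) = c (ω i b)})
            (fun _ _ => by positivity) (mem_univ c))
      have h2 : (1 : ℝ) = 2 ^ (2 * C) * (1 / 2) ^ (2 * C) := by
        rw [← mul_pow, mul_one_div_cancel two_ne_zero, one_pow]
      have h3 : (0 : ℝ) ≤ (#(denseSubfamilies q s ω) : ℝ) / (2 * C + 1) := 
        div_nonneg (Nat.cast_nonneg _) (by positivity)
      have h4 := mul_le_mul_of_nonneg_left h1 (show (0 : ℝ) ≤ 2 ^ (2 * C) by positivity)
      linarith
  have hcardΩ : (Fintype.card (Fin (A * n) → V → Fin n) : ℝ) = P := by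
    rw [Fintype.card_fun, Fintype.card_fun, Fintype.card_fin, Fintype.card_fin, hq, hP]
    push_cast
    rfl
  have htotal := sum_le_sum fun ω (_ : ω ∈ (univ : Finset (Fin (A * n) → V → Fin n))) => hone ω
  rw [sum_const, card_univ, nsmul_eq_mul, mul_one, hcardΩ, sum_add_distrib, ← sum_div,
    ← mul_sum, sum_comm] at htotal
  have hcol : ∑ c : Fin n → Fin k, ∑ ω : Fin (A * n) → V → Fin n,
      (1 / 2 : ℝ) ^ #{i | ∀ a b, c (ω i a) = c (ω i b)} ≤ P * (1 / 2) ^ n := by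
    calc
      _ ≤ ∑ _c : Fin n → Fin k, P * (β ^ A) ^ n := sum_le_sum fun c _ => hmono c
      _ = P * (k * β ^ A) ^ n := by
        rw [sum_const, card_univ, Fintype.card_fun, Fintype.card_fin, Fintype.card_fin,
          nsmul_eq_mul, mul_pow]
        push_cast
        ring
      _ ≤ _ := by gcongr
  have hsmall : (2 : ℝ) ^ (2 * C) * (P * (1 / 2) ^ n) ≤ P / 4 := by
    calc
      _ ≤ (2 : ℝ) ^ (2 * C) * (P * (1 / 2) ^ (2 * C + 2)) := by
        gcongr ?_ * (?_ * ?_)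
        exact pow_le_pow_of_le_one (by norm_num) (by norm_num) hn2
      _ = (2 * (1 / 2) : ℝ) ^ (2 * C) * (P / 4) := by rw [mul_pow]; ring
      _ = P / 4 := by norm_num
  have hhalf : (∑ ω : Fin (A * n) → V → Fin n, (#(denseSubfamilies q s ω) : ℝ)) / (2 * C + 1) ≤
      P / 2 := by
    rw [div_le_div_iff₀ (by positivity) (by norm_num)]
    nlinarith
  have := mul_le_mul_of_nonneg_left hcol (show (0 : ℝ) ≤ 2 ^ (2 * C) by positivity)
  linarith

/-- Hypergraphs of large girth and large chromatic number exist (Erdős and Hajnal): a locally sparse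
system of hyperedges that covers all points and has a monochromatic member in every coloring with
`k` colors. -/
theorem exists_locallySparse_not_colorable {q k : ℕ} (hq : Fintype.card V = q + 1) (hk : 0 < k)
    {s : ℕ} (hs : 0 < s) :
    ∃ (N : ℕ) (ι : Type) (e : ι → V ↪ Fin N),
      LocallySparse q s (fun i => univ.map (e i)) ∧ (∀ y, ∃ i a, e i a = y) ∧
      ∀ c : Fin N → Fin k, ∃ i, ∀ a b, c (e i a) = c (e i b) := by
  classical
  obtain ⟨n, M, ω, hω⟩ := exists_few_denseSubfamilies_many_monochromatic hq hk s
  -- Deleting one index from each violating set leaves a sparse system, in which every coloring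
  -- still has a monochromatic tuple.
  have hpick : ∀ T : denseSubfamilies q s ω, ∃ i, i ∈ T.1 :=
    fun T => (mem_denseSubfamilies.mp T.2).1
  choose pick hpick using hpick
  set D := univ.image pick with hD
  have hDcard : #D ≤ #(denseSubfamilies q s ω) := card_image_le.trans_eq (by simp)
  let ι := {i : Fin M // i ∉ D}
  have hsparse : ∀ T : Finset ι, T.Nonempty → #T ≤ s →
      q * #T < #(T.biUnion fun i => univ.image (ω i)) := by
    intro T hT hTs
    by_contra! hcon
    have hmem : T.map (Function.Embedding.subtype _) ∈ denseSubfamilies q s ω := by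
      refine mem_denseSubfamilies.mpr ⟨hT.map, by simpa using hTs, ?_⟩
      rw [card_map, map_eq_image, image_biUnion]
      exact hcon
    obtain ⟨i, -, hi⟩ := mem_map.mp (hpick ⟨_, hmem⟩)
    have hiD : (i : Fin M) ∈ D := by
      rw [Function.Embedding.subtype_apply] at hi
      rw [hi]
      exact mem_image_of_mem _ (mem_univ _)
    exact i.2 hiD
  -- Points covered by no remaining tuple are dropped.
  let X := {x : Fin n // ∃ (i : ι) (a : V), ω i a = x}
  obtain ⟨N, ⟨φ⟩⟩ := Finite.exists_equiv_fin X
  let ψ : Fin N → Fin n := fun y => (φ.symm y).1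
  have hψ : Function.Injective ψ := Subtype.val_injective.comp φ.symm.injective
  let e : ι → V → Fin N := fun i a => φ ⟨ω i a, i, a, rfl⟩
  have hψe : ∀ i a, ψ (e i a) = ω i a := by simp [ψ, e]
  have himage : ∀ T : Finset ι, T.biUnion (fun i => univ.image (ω i)) =
      (T.biUnion fun i => univ.image (e i)).image ψ := by
    intro T
    simp only [biUnion_image, image_image]
    refine biUnion_congr rfl fun i _ => image_congr fun a _ => (hψe i a).symm
  have hsparse' : LocallySparse q s (fun i => univ.image (e i)) := by
    intro T hT hTs
    have := hsparse T hT hTs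
    rw [himage] at this
    exact this.trans_le card_image_le
  have hinj : ∀ i, Function.Injective (e i) := by
    intro i
    have := hsparse' {i} (singleton_nonempty i) (by rw [card_singleton]; exact hs)
    rw [singleton_biUnion, card_singleton, mul_one] at this
    rw [← Set.injOn_univ, ← coe_univ]
    refine card_image_iff.mp (le_antisymm card_image_le ?_)
    rw [card_univ, hq]
    exact this
  refine ⟨N, ι, fun i => ⟨e i, hinj i⟩, ?_, ?_, ?_⟩
  · simpa only [map_eq_image, Function.Embedding.coeFn_mk] using hsparse'
  · intro y
    obtain ⟨i, a, h⟩ := (φ.symm y).2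
    exact ⟨i, a, hψ ((hψe i a).trans h)⟩
  · intro c
    let c' : Fin n → Fin k := Function.extend ψ c fun _ => ⟨0, hk⟩
    have hc' : ∀ (i : ι) a, c' (ω i a) = c (e i a) := by
      intro i a
      rw [← hψe]
      exact hψ.extend_apply _ _ _
    obtain ⟨i, hi, hiD⟩ := exists_mem_notMem_of_card_lt_card (hDcard.trans_lt (hω c'))
    let i' : ι := ⟨i, hiD⟩
    refine ⟨i', fun a b => ?_⟩
    have := (mem_filter.mp hi).2 a b
    exact (hc' i' a).symm.trans (this.trans (hc' i' b))

end RandomHypergraph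

/-! ### Graphs without prescribed subgraphs and with prescribed `H`-chromatic number -/

theorem exists_free_hChromaticNumber_eq {V : Type*} [Finite V] [Nontrivial V]
    (H : SimpleGraph V) (m : ℕ) (W : Fin m → Type*) [∀ i, Finite (W i)]
    (F : ∀ i, SimpleGraph (W i)) (hF : ∀ i, ¬ IsHForest H (F i)) (k : ℕ) (hk : 1 ≤ k) :
    ∃ (n : ℕ) (G : SimpleGraph (Fin n)),
      (∀ i, (F i).Free G) ∧ hChromaticNumber H G = (k : ℕ∞) := by
  have := Fintype.ofFinite V
  obtain ⟨q, hq⟩ := Nat.exists_eq_succ_of_ne_zero (Fintype.card_ne_zero (α := V))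
  let s := 2 + ∑ i, Nat.card (W i)
  obtain ⟨N, ι, e, hsparse, hcov, hcol⟩ := exists_locallySparse_not_colorable hq hk
    (show 0 < s by lia)
  have hnot := not_isHColorable_hyperedgeGraph H hcol
  obtain ⟨k, rfl⟩ := Nat.exists_eq_add_of_le' hk
  obtain ⟨n, G, hG, hchi⟩ := exists_hChromaticNumber_eq_succ
    (fun h => hnot (h.mono (Nat.le_succ k)))
  refine ⟨n, G, fun i hi => hF i ?_, hchi⟩
  refine isHForest_of_isContained_hyperedgeGraph hq (s := s) (by lia) ?_ hsparse hcov (hi.trans hG)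
  have := Finset.single_le_sum (f := fun i => Nat.card (W i)) (fun _ _ => Nat.zero_le _)
    (Finset.mem_univ i)
  exact this.trans (Nat.le_add_left _ _)

end GeneralizedColoring

theorem mainTheorem2 {V : Type*} [Finite V] [Nontrivial V] (H : SimpleGraph V) :
    (∀ (m : ℕ) (W : Fin m → Type*) [∀ i, Finite (W i)] (F : ∀ i, SimpleGraph (W i)),
      (∀ i, ¬ GeneralizedColoring.IsHForest H (F i)) →
      ∀ k : ℕ, 1 ≤ k → ∃ (n : ℕ) (G : SimpleGraph (Fin n)),
        (∀ i, (F i).Free G) ∧ GeneralizedColoring.hChromaticNumber H G = (k : ℕ∞)) ∧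
    (∀ m : ℕ, 3 ≤ m → (m : ℕ∞) < H.egirth →
      ¬ GeneralizedColoring.IsHForest H (SimpleGraph.cycleGraph m) ∧
      ∀ k : ℕ, ∃ (n : ℕ) (G : SimpleGraph (Fin n)),
        (SimpleGraph.cycleGraph m).Free G ∧
          (k : ℕ∞) ≤ GeneralizedColoring.hChromaticNumber H G) := by
  refine ⟨GeneralizedColoring.exists_free_hChromaticNumber_eq H, fun m hm hgirth => ?_⟩
  have hnot : ¬ GeneralizedColoring.IsHForest H (SimpleGraph.cycleGraph m) :=
    fun h => hgirth.not_ge (h.egirth_le hm)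
  refine ⟨hnot, fun k => ?_⟩
  obtain ⟨n, G, hfree, hchi⟩ := GeneralizedColoring.exists_free_hChromaticNumber_eq H 1
    (fun _ => Fin m) (fun _ => SimpleGraph.cycleGraph m) (fun _ => hnot) (k + 1) (by lia)
  refine ⟨n, G, hfree 0, ?_⟩
  rw [hchi]
  exact_mod_cast Nat.le_succ k
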